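/- **Theorem 4.4.** Fix $T>0$. On a probability space $(\Omega,\mathcal F,\mathbb P)$ let $(\Theta_i)_{i\ge 0}$ be i.i.d. real random variables with finite mean $\theta$ and finite variance $\sigma_\Theta^2$, and for each $n\in\mathbb N=\{1,2,\dots\}$ let $(X^n_i)_{i\ge0}$ be i.i.d. real random variables, independent of $(\Theta_i)_{i\ge0}$, with finite mean $\mu_n$ and finite variance $\sigma_{X,n}^2$, such that $\mu_n\to\mu\in\mathbb R$ and $\sigma^2_{X,n}\to\sigma_X^2$ for some $\sigma_X>0$. Let $(b_n)_{n\in\mathbb N}$ be real numbers with $b_n\to\infty$ and $b_n/\sqrt n\to0$. Assume that * for some $a>0$, $\mathbb E[e^{a|\Theta_0|}]<\infty$ and $\sup_{n\in\mathbb N}\mathbb E[e^{a|X^n_0|}]<\infty$; * $\frac{\sqrt n}{b_n}(\mu_n-\mu)\to r$ for some $r\in\mathbb R$. Let $V^n_0$ be real random variables and define $$V^n_{i+1}=\Bigl(1-\tfrac1n\Theta_i\Bigr)V^n_i+X^n_i,\qquad i\ge 0.$$ Assume that either $\theta>0$, in which case put $\bar V^*=\mu/\theta$, or $\theta=\mu=0$,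 in which case put $\bar V^*=0$ (the stable fixed point of the fluid equation $\dot v=\mu-\theta v$). Define $$\widetilde V^n(t)=\frac{\sqrt n}{b_n}\Bigl(\frac1n V^n_{\lfloor nt\rfloor}-\bar V^*\Bigr),\qquad t\in[0,T],$$ and assume that $\widetilde V^n(0)$ converges super-exponentially in probability to some $v_0\in\mathbb R$ with rate $b_n^2$, that is, for every $\delta>0$, $$\lim_{n\to\infty}\frac1{b_n^2}\log\mathbb P\bigl(|\widetilde V^n(0)-v_0|>\delta\bigr)=-\infty .$$ Then the family $\{\widetilde V^n\}_{n\in\mathbb N}$ is exponentially tight with rate $b_n^2$ in the space $\mathcal D_T=\mathcal D([0,T],\mathbb R)$ of càdlàg functions with the Skorokhod $J_1$ topology: for every $\alpha\ge0$ there is a compact set $K_\alpha\subset\mathcal D_T$ with $$\limsup_{n\to\infty}\frac1{b_n^2}\log\mathbb P\bigl(\widetilde V^n\notin K_\alpha\bigr)<-\alpha .$$ Here $\log 0=-\infty$. -/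

import Mathlib

open MeasureTheory ProbabilityTheory Filter Topology Set
open scoped ENNReal

/-- A real function on `[0,T]` is càdlàg: right continuous with finite left limits
(at `0` the left limit condition is void). -/
def IsCadlag {T : ℝ} (x : Icc (0 : ℝ) T → ℝ) : Prop :=
  ∀ t, ContinuousWithinAt x (Ici t) t ∧ ∃ l : ℝ, Tendsto x (𝓝[<] t) (𝓝 l)

/-- The space `D([0,T], ℝ)` of càdlàg functions. -/
structure SkorokhodSpace (T : ℝ) where
  toFun : Icc (0 : ℝ) T → ℝ
  cadlag : IsCadlag toFun

namespace SkorokhodSpace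

variable {T : ℝ}

/-- The cost of matching the path `x` with the path `y` through the time change `lam`:
the maximum of `sup_t |lam t - t|` and `sup_t |x t - y (lam t)|`. -/
noncomputable def cost (x y : SkorokhodSpace T) (lam : Icc (0 : ℝ) T ≃o Icc (0 : ℝ) T) : ℝ≥0∞ :=
  max (⨆ t, edist (lam t) t) (⨆ t, edist (x.toFun t) (y.toFun (lam t)))

/-- The Skorokhod `J₁` distance: infimum of the cost over all increasing bijections of `[0,T]`
(these are exactly the increasing homeomorphisms of `[0,T]`). -/
noncomputable instance : EDist (SkorokhodSpace T) :=
  ⟨fun x y => ⨅ lam : Icc (0 : ℝ) T ≃o Icc (0 : ℝ) T, cost x y lam⟩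

theorem edist_eq (x y : SkorokhodSpace T) :
    edist x y = ⨅ lam : Icc (0 : ℝ) T ≃o Icc (0 : ℝ) T, cost x y lam := rfl

theorem cost_refl (x : SkorokhodSpace T) : cost x x (OrderIso.refl _) = 0 := by
  simp [cost]

theorem cost_symm_le (x y : SkorokhodSpace T) (lam : Icc (0 : ℝ) T ≃o Icc (0 : ℝ) T) :
    cost y x lam.symm ≤ cost x y lam := by
  refine max_le_max (iSup_le fun t => ?_) (iSup_le fun t => ?_)
  · have h := le_iSup (fun s => edist (lam s) s) (lam.symm t)
    simpa [edist_comm] using h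
  · have h := le_iSup (fun s => edist (x.toFun s) (y.toFun (lam s))) (lam.symm t)
    simpa [edist_comm] using h

theorem cost_trans_le (x y z : SkorokhodSpace T) (lam nu : Icc (0 : ℝ) T ≃o Icc (0 : ℝ) T) :
    cost x z (lam.trans nu) ≤ cost x y lam + cost y z nu := by
  refine max_le (iSup_le fun t => ?_) (iSup_le fun t => ?_)
  · have h1 : edist (lam t) t ≤ cost x y lam :=
      (le_iSup (fun s => edist (lam s) s) t).trans (le_max_left _ _)
    have h2 : edist (nu (lam t)) (lam t) ≤ cost y z nu :=
      (le_iSup (fun s => edist (nu s) s) (lam t)).trans (le_max_left _ _)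
    calc edist ((lam.trans nu) t) t ≤ edist (nu (lam t)) (lam t) + edist (lam t) t :=
          edist_triangle _ _ _
      _ ≤ cost y z nu + cost x y lam := add_le_add h2 h1
      _ = cost x y lam + cost y z nu := add_comm _ _
  · have h1 : edist (x.toFun t) (y.toFun (lam t)) ≤ cost x y lam :=
      (le_iSup (fun s => edist (x.toFun s) (y.toFun (lam s))) t).trans (le_max_right _ _)
    have h2 : edist (y.toFun (lam t)) (z.toFun (nu (lam t))) ≤ cost y z nu :=
      (le_iSup (fun s => edist (y.toFun s) (z.toFun (nu s))) (lam t)).trans (le_max_right _ _)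
    exact (edist_triangle _ _ _).trans (add_le_add h1 h2)

/-- `D([0,T], ℝ)` with the Skorokhod `J₁` distance; its topology is the `J₁` topology. -/
noncomputable instance : PseudoEMetricSpace (SkorokhodSpace T) where
  edist_self x := by
    refine le_antisymm ?_ zero_le
    exact (iInf_le _ (OrderIso.refl _)).trans (cost_refl x).le
  edist_comm x y := by
    have key : ∀ u v : SkorokhodSpace T, edist u v ≤ edist v u := fun u v =>
      le_iInf fun lam => (iInf_le _ lam.symm).trans (cost_symm_le v u lam)
    exact le_antisymm (key x y) (key y x)
  edist_triangle x y z := by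
    rw [edist_eq x y, edist_eq y z, ENNReal.iInf_add]
    refine le_iInf fun lam => ?_
    rw [ENNReal.add_iInf]
    exact le_iInf fun nu => (iInf_le _ (lam.trans nu)).trans (cost_trans_le x y z lam nu)

end SkorokhodSpace

theorem isCadlag_floor (T : ℝ) (n : ℕ) (g : ℕ → ℝ) :
    IsCadlag (fun t : Icc (0 : ℝ) T => g ⌊(n : ℝ) * (t : ℝ)⌋₊) := by
  intro t
  have hm : Monotone fun s : Icc (0 : ℝ) T => (n : ℝ) * (s : ℝ) := fun s u h =>
    mul_le_mul_of_nonneg_left h (Nat.cast_nonneg n)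
  have hc : Continuous fun s : Icc (0 : ℝ) T => (n : ℝ) * (s : ℝ) := by fun_prop
  constructor
  · have h1 : Tendsto (fun s : Icc (0 : ℝ) T => (n : ℝ) * (s : ℝ)) (𝓝[≥] t)
        (𝓝[≥] ((n : ℝ) * (t : ℝ))) :=
      tendsto_nhdsWithin_iff.2 ⟨hc.continuousWithinAt,
        eventually_nhdsWithin_of_forall fun s hs => hm hs⟩
    have h2 := tendsto_pure.1 ((tendsto_floor_right_pure_floor ((n : ℝ) * (t : ℝ))).comp h1)
    refine tendsto_nhds_of_eventually_eq (h2.mono fun s hs => ?_)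
    simp only [Function.comp] at hs
    simp only [← Int.floor_toNat, hs]
  · rcases Nat.eq_zero_or_pos n with rfl | hn
    · exact ⟨g 0, by simpa using tendsto_const_nhds⟩
    · have h1 : Tendsto (fun s : Icc (0 : ℝ) T => (n : ℝ) * (s : ℝ)) (𝓝[<] t)
          (𝓝[<] ((n : ℝ) * (t : ℝ))) :=
        tendsto_nhdsWithin_iff.2 ⟨hc.continuousWithinAt,
          eventually_nhdsWithin_of_forall fun s hs =>
            mul_lt_mul_of_pos_left (show (s : ℝ) < t from hs) (Nat.cast_pos.2 hn)⟩
      have h2 := tendsto_pure.1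
        ((tendsto_floor_left_pure_ceil_sub_one ((n : ℝ) * (t : ℝ))).comp h1)
      refine ⟨g (⌈(n : ℝ) * (t : ℝ)⌉ - 1).toNat,
        tendsto_nhds_of_eventually_eq (h2.mono fun s hs => ?_)⟩
      simp only [Function.comp] at hs
      simp only [← Int.floor_toNat, hs]

/-- The random elements `x n` are exponentially tight with rate `a n`: for every `α ≥ 0` there is a
compact `K` with `limsup_n (1 / a n) log P (x n ∉ K) < -α` (extended real values, `log 0 = -∞`). -/
def ExponentiallyTight {Ω E : Type*} [MeasurableSpace Ω] [TopologicalSpace E] (P : Measure Ω)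
    (x : ℕ → Ω → E) (a : ℕ → ℝ) : Prop :=
  ∀ α : ℝ, 0 ≤ α → ∃ K : Set E, IsCompact K ∧
    limsup (fun n => ((1 / a n : ℝ) : EReal) * ENNReal.log (P {ω | x n ω ∉ K})) atTop
      < ((-α : ℝ) : EReal)

/-- The random elements `x n` converge super-exponentially in probability to the point `x₀` with
rate `a n`: `lim_n (1 / a n) log P (dist (x n) x₀ > δ) = -∞` for every `δ > 0`. -/
def SuperExpConverges {Ω E : Type*} [MeasurableSpace Ω] [PseudoMetricSpace E] (P : Measure Ω)
    (x : ℕ → Ω → E) (x₀ : E) (a : ℕ → ℝ) : Prop :=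
  ∀ δ : ℝ, 0 < δ →
    Tendsto (fun n => ((1 / a n : ℝ) : EReal) * ENNReal.log (P {ω | δ < dist (x n ω) x₀}))
      atTop (𝓝 ⊥)

/-- The `n`-th linear recursion `V (i+1) = C i * V i + X i` with `C i = 1 - Θ i / n`, started from
`V0`. -/
noncomputable def linRec {Ω : Type*} (n : ℕ) (Θ X : ℕ → Ω → ℝ) (V0 : Ω → ℝ) : ℕ → Ω → ℝ
  | 0, ω => V0 ω
  | i + 1, ω => (1 - Θ i ω / n) * linRec n Θ X V0 i ω + X i ω

/-- The moderate deviation scaling `(√n / b) (v / n - vstar)` of a value `v` of the `n`-th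
system. -/
noncomputable def mdScale (n : ℕ) (b vstar v : ℝ) : ℝ :=
  Real.sqrt n / b * (v / n - vstar)

/-- The moderate-deviation-scaled process `t ↦ (√n / b) (V ⌊n t⌋ / n - vstar)`, `t ∈ [0,T]`, as a
random element of `D([0,T], ℝ)`. -/
noncomputable def mdProcess {Ω : Type*} (T : ℝ) (n : ℕ) (b vstar : ℝ) (V : ℕ → Ω → ℝ) (ω : Ω) :
    SkorokhodSpace T where
  toFun t := mdScale n b vstar (V ⌊(n : ℝ) * (t : ℝ)⌋₊ ω)
  cadlag := isCadlag_floor T n fun i => mdScale n b vstar (V i ω)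

/-- `v` is the stable fixed point of the fluid equation `v' = μ - θ v`: it is `μ / θ` if `θ > 0`;
if `θ = μ = 0`, where every point is fixed, it is by convention `0`; in all other cases there is
none. -/
def IsStableFixedPoint (θ μ v : ℝ) : Prop :=
  (0 < θ ∧ v = μ / θ) ∨ (θ = 0 ∧ μ = 0 ∧ v = 0)

/-! Let `w i` be the scaled value at step `i`. Since `θ * vstar = μ`, the centring removes the
deterministic drift: `w` solves `w (i+1) = (1 - Θ i / n) w i + ξ i`, where `ξ i` consists of the
centred `X n i` and `Θ i` divided by `b n √n`, plus a bias of order `1 / n`.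

Probabilistic input: Doob's inequality for exponential martingales bounds the probability that a
centred sum over at most `⌊n δ⌋ + 1` terms reaches `η b n √n` by `exp ((1 - κ η + C κ² δ) b n²)`,
for any `κ ≥ 0` and all large `n`. The exponent is as negative as desired either for fixed `η` and
small `δ`, or for fixed `δ` and large `η`. This is applied to `X n`, to `Θ`, and to `|Θ|`, which
controls the random coefficients. On the resulting good event a discrete Grönwall argument bounds
`w` up to time `T`, and the recursion then bounds its oscillation over cells of length `δ`
(`exists_measure_mdScale_linRec_le`).

Compactness: such a path is uniformly close to a bounded step function on a grid independent of `n`,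
hence to one of finitely many functions. Imposing this at every precision `1 / (k + 1)` gives a
totally bounded set for the uniform distance. Its uniform closure is compact, and stays compact in
`J₁` because `J₁` is the weaker distance (`exponentiallyTight_of_oscillation`). -/

/-! ### Compact sets of càdlàg functions -/

/-- Uniform limits of càdlàg functions are càdlàg. -/
theorem isClosed_setOf_isCadlag (T : ℝ) :
    IsClosed {f : UniformFun (Icc (0 : ℝ) T) ℝ | IsCadlag (UniformFun.toFun f)} := by
  refine isClosed_of_closure_subset fun f hf t => ?_
  have happ : ∀ ε : ℝ, 0 < ε → ∃ g : Icc (0 : ℝ) T → ℝ, IsCadlag g ∧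
      ∀ s, dist (UniformFun.toFun f s) (g s) < ε := by
    intro ε hε
    obtain ⟨g, hg, hfg⟩ := EMetric.mem_closure_iff.1 hf _ (ENNReal.ofReal_pos.2 hε)
    refine ⟨UniformFun.toFun g, hg, fun s => ?_⟩
    have h := (UniformFun.edist_eval_le (x := s)).trans_lt hfg
    rwa [edist_dist, ENNReal.ofReal_lt_ofReal_iff hε] at h
  constructor
  · rw [Metric.continuousWithinAt_iff']
    intro ε hε
    obtain ⟨g, hg, hfg⟩ := happ (ε / 3) (by positivity)
    filter_upwards [Metric.continuousWithinAt_iff'.1 (hg t).1 (ε / 3) (by positivity)] with s hs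
    have h1 := dist_triangle4 (UniformFun.toFun f s) (g s) (g t) (UniformFun.toFun f t)
    have h2 := hfg t
    rw [dist_comm] at h2
    linarith [hfg s]
  · rcases (𝓝[<] t).eq_or_neBot with h | h
    · exact ⟨0, by simp [h]⟩
    · have hC : Cauchy (map (UniformFun.toFun f) (𝓝[<] t)) := by
        refine Metric.cauchy_iff.2 ⟨inferInstance, fun ε hε => ?_⟩
        obtain ⟨g, hg, hfg⟩ := happ (ε / 4) (by positivity)
        obtain ⟨l, hl⟩ := (hg t).2
        have hs := Metric.tendsto_nhds.1 hl (ε / 4) (by positivity)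
        refine ⟨_, image_mem_map hs, ?_⟩
        rintro _ ⟨u, hu, rfl⟩ _ ⟨v, hv, rfl⟩
        have h1 := dist_triangle (UniformFun.toFun f u) (g u) l
        have h2 := dist_triangle (UniformFun.toFun f v) (g v) l
        have h3 := dist_triangle_right (UniformFun.toFun f u) (UniformFun.toFun f v) l
        have hu' : dist (g u) l < ε / 4 := hu
        have hv' : dist (g v) l < ε / 4 := hv
        linarith [hfg u, hfg v]
      exact CompleteSpace.complete hC

/-- The `J₁` distance is at most the uniform distance. -/
theorem SkorokhodSpace.edist_le_iSup {T : ℝ} (x y : SkorokhodSpace T) :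
    edist x y ≤ ⨆ t, edist (x.toFun t) (y.toFun t) := by
  rw [SkorokhodSpace.edist_eq]
  refine (iInf_le _ (OrderIso.refl _)).trans ?_
  simp [SkorokhodSpace.cost]

/-- A set of càdlàg functions that is totally bounded for the uniform distance is contained in a
compact subset of the Skorokhod space. -/
theorem SkorokhodSpace.exists_isCompact_of_totallyBounded {T : ℝ}
    {S : Set (UniformFun (Icc (0 : ℝ) T) ℝ)} (hS : TotallyBounded S)
    (hc : S ⊆ {f | IsCadlag (UniformFun.toFun f)}) :
    ∃ K : Set (SkorokhodSpace T), IsCompact K ∧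
      ∀ x : SkorokhodSpace T, UniformFun.ofFun x.toFun ∈ S → x ∈ K := by
  let φ : {f : UniformFun (Icc (0 : ℝ) T) ℝ | IsCadlag (UniformFun.toFun f)} → SkorokhodSpace T :=
    fun f => ⟨UniformFun.toFun f.1, f.2⟩
  have hφ : LipschitzWith 1 φ := fun f g => by
    rw [ENNReal.coe_one, one_mul]
    exact SkorokhodSpace.edist_le_iSup _ _
  have hK : IsCompact (closure S) :=
    isCompact_iff_totallyBounded_isComplete.2 ⟨hS.closure, isClosed_closure.isComplete⟩
  -- The limit points are still càdlàg, so `φ` is defined on the whole compact closure.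
  have hsub : closure S ⊆ {f | IsCadlag (UniformFun.toFun f)} :=
    closure_minimal hc (isClosed_setOf_isCadlag T)
  refine ⟨φ '' (Subtype.val ⁻¹' closure S), IsCompact.image ?_ hφ.continuous, fun x hx => ?_⟩
  · rw [Subtype.isCompact_iff, Subtype.image_preimage_coe, inter_eq_right.2 hsub]
    exact hK
  · exact ⟨⟨UniformFun.ofFun x.toFun, x.cadlag⟩, subset_closure hx, rfl⟩

/-- Paths that are, for every `k`, uniformly `ε k`-close to a member of the finite set `F k` lie in
a common compact set of the Skorokhod space, if `ε k → 0`. -/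
theorem SkorokhodSpace.exists_isCompact_of_finite_nets {T : ℝ} {F : ℕ → Set (Icc (0 : ℝ) T → ℝ)}
    (hF : ∀ k, (F k).Finite) {ε : ℕ → ℝ} (hε : Tendsto ε atTop (𝓝 0)) :
    ∃ K : Set (SkorokhodSpace T), IsCompact K ∧
      ∀ x : SkorokhodSpace T, (∀ k, ∃ f ∈ F k, ∀ t, |x.toFun t - f t| ≤ ε k) → x ∈ K := by
  suffices h : TotallyBounded {f : UniformFun (Icc (0 : ℝ) T) ℝ | IsCadlag (UniformFun.toFun f) ∧
      ∀ k, ∃ g ∈ F k, ∀ t, |UniformFun.toFun f t - g t| ≤ ε k} by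
    obtain ⟨K, hK, hKS⟩ := SkorokhodSpace.exists_isCompact_of_totallyBounded h fun f hf => hf.1
    exact ⟨K, hK, fun x hx => hKS x ⟨x.cadlag, hx⟩⟩
  refine EMetric.totallyBounded_iff.2 fun e he => ?_
  obtain ⟨d, hd0, hde⟩ := ENNReal.lt_iff_exists_nnreal_btwn.1 he
  have hd : (0 : ℝ) < d := by exact_mod_cast hd0
  obtain ⟨k, hk⟩ := ((tendsto_order.1 hε).2 _ hd).exists
  refine ⟨UniformFun.ofFun '' F k, (hF k).image _, fun f hf => ?_⟩
  obtain ⟨g, hg, hfg⟩ := hf.2 k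
  refine mem_iUnion₂.2 ⟨_, mem_image_of_mem _ hg, ?_⟩
  refine lt_of_le_of_lt (UniformFun.edist_le.2 fun t => ?_) hde
  rw [edist_dist, Real.dist_eq]
  exact (ENNReal.ofReal_le_ofReal ((hfg t).trans hk.le)).trans (by simp)

/-- For `q` with values below `m`, finitely many functions of `q` approximate, up to `ε`, all
functions that are bounded by `M` and `ε / 2`-close to a function of `q`. -/
theorem exists_finite_net {ι : Type*} (q : ι → ℕ) (m : ℕ) (hq : ∀ t, q t < m) (M : ℝ) {ε : ℝ}
    (hε : 0 < ε) : ∃ F : Set (ι → ℝ), F.Finite ∧ ∀ x : ι → ℝ, ∀ c : ℕ → ℝ,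
      (∀ k < m, |c k| ≤ M) → (∀ t, |x t - c (q t)| ≤ ε / 2) → ∃ f ∈ F, ∀ t, |x t - f t| ≤ ε := by
  obtain ⟨s, hs, hsM⟩ := Metric.totallyBounded_iff.1
    (isCompact_Icc (a := -M) (b := M)).totallyBounded (ε / 2) (by positivity)
  -- One value of the `ε / 2`-net of `[-M, M]` for each of the `m` labels.
  refine ⟨(fun (d : Fin m → ℝ) t => d ⟨q t, hq t⟩) '' {d | ∀ k, d k ∈ s},
    (Set.Finite.pi' fun _ => hs).image _, fun x c hc hx => ?_⟩
  have h : ∀ k : Fin m, ∃ y ∈ s, |c k - y| < ε / 2 := fun k => by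
    simpa [Real.dist_eq] using hsM (show c k ∈ Icc (-M) M from abs_le.1 (hc k k.2))
  choose d hds hd using h
  refine ⟨_, ⟨d, hds, rfl⟩, fun t => ?_⟩
  have h1 := abs_sub_le (x t) (c (q t)) (d ⟨q t, hq t⟩)
  linarith [hx t, (hd ⟨q t, hq t⟩).le]

/-! ### A maximal exponential inequality -/

theorem Real.exp_le_one_add_add_sq_mul_exp_abs (y : ℝ) :
    Real.exp y ≤ 1 + y + y ^ 2 * Real.exp |y| := by
  have h1 : 1 ≤ Real.exp |y| := Real.one_le_exp (abs_nonneg y)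
  have h2 : y ^ 2 ≤ y ^ 2 * Real.exp |y| := le_mul_of_one_le_right (sq_nonneg y) h1
  rcases le_or_gt |y| 1 with h | h
  · linarith [(abs_le.1 (Real.abs_exp_sub_one_sub_id_le h)).2]
  · rcases le_or_gt 0 y with hy | hy
    · rw [abs_of_nonneg hy] at *
      have h3 : 1 * Real.exp y ≤ y ^ 2 * Real.exp y :=
        mul_le_mul_of_nonneg_right (by nlinarith) (Real.exp_pos y).le
      linarith
    · rw [abs_of_neg hy] at h
      have h3 : Real.exp y ≤ 1 := Real.exp_le_one_iff.2 hy.le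
      nlinarith

/-- Half of the exponential moment of order `a` pays for the square; the other half is left for `exp
|l * x|`, whence the restriction `|l| ≤ a / 2` below. -/
theorem sq_le_mul_exp_mul_abs {a : ℝ} (ha : 0 < a) (x : ℝ) :
    x ^ 2 ≤ 8 / a ^ 2 * Real.exp (a / 2 * |x|) := by
  have h := Real.quadratic_le_exp_of_nonneg (x := a / 2 * |x|) (by positivity)
  have h1 : (a / 2 * |x|) ^ 2 = a ^ 2 / 4 * x ^ 2 := by rw [mul_pow, sq_abs]; ring
  have h2 : 0 ≤ a / 2 * |x| := by positivity
  rw [div_mul_eq_mul_div, le_div_iff₀ (by positivity)]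
  nlinarith

section

variable {Ω : Type*} [MeasurableSpace Ω] {P : Measure Ω}

theorem integrable_exp_mul_of_abs_le {Y : Ω → ℝ} (hY : Measurable Y) {a l : ℝ}
    (hint : Integrable (fun ω => Real.exp (a * |Y ω|)) P) (hl : |l| ≤ a) :
    Integrable (fun ω => Real.exp (l * Y ω)) P := by
  refine hint.mono' (by fun_prop) (ae_of_all _ fun ω => ?_)
  rw [Real.norm_eq_abs, Real.abs_exp, Real.exp_le_exp]
  exact (le_abs_self _).trans (abs_mul l _ ▸ mul_le_mul_of_nonneg_right hl (abs_nonneg _))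

theorem integrable_of_integrable_exp_mul_abs {Y : Ω → ℝ} (hY : Measurable Y) {a : ℝ} (ha : 0 < a)
    (hint : Integrable (fun ω => Real.exp (a * |Y ω|)) P) : Integrable Y P := by
  refine (hint.const_mul a⁻¹).mono' hY.aestronglyMeasurable (ae_of_all _ fun ω => ?_)
  rw [Real.norm_eq_abs, ← div_eq_inv_mul, le_div_iff₀ ha]
  linarith [Real.add_one_le_exp (a * |Y ω|)]

variable [IsProbabilityMeasure P]

/-- A variable with an exponential moment has a sub-Gaussian moment generating function near `0`. -/
theorem mgf_le_exp_of_integrable_exp_mul_abs {Y : Ω → ℝ} (hY : Measurable Y) {a M l : ℝ}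
    (ha : 0 < a) (hint : Integrable (fun ω => Real.exp (a * |Y ω|)) P)
    (hM : ∫ ω, Real.exp (a * |Y ω|) ∂P ≤ M) (hl : |l| ≤ a / 2) :
    mgf Y P l ≤ Real.exp (l * ∫ ω, Y ω ∂P + 8 * M / a ^ 2 * l ^ 2) := by
  have hYi := integrable_of_integrable_exp_mul_abs hY ha hint
  have hpt : ∀ ω, Real.exp (l * Y ω) ≤
      1 + l * Y ω + l ^ 2 * (8 / a ^ 2) * Real.exp (a * |Y ω|) := fun ω => by
    refine (Real.exp_le_one_add_add_sq_mul_exp_abs _).trans (add_le_add le_rfl ?_)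
    have h1 : Real.exp |l * Y ω| ≤ Real.exp (a / 2 * |Y ω|) := by
      rw [abs_mul]
      exact Real.exp_le_exp.2 (mul_le_mul_of_nonneg_right hl (abs_nonneg _))
    have h2 : Real.exp (a * |Y ω|) = Real.exp (a / 2 * |Y ω|) * Real.exp (a / 2 * |Y ω|) := by
      rw [← Real.exp_add]; ring_nf
    rw [h2, mul_pow]
    calc l ^ 2 * Y ω ^ 2 * Real.exp |l * Y ω|
        ≤ l ^ 2 * (8 / a ^ 2 * Real.exp (a / 2 * |Y ω|)) * Real.exp (a / 2 * |Y ω|) := by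
          gcongr
          exact sq_le_mul_exp_mul_abs ha _
      _ = _ := by ring
  have h1 : mgf Y P l ≤ 1 + l * ∫ ω, Y ω ∂P + l ^ 2 * (8 / a ^ 2) * M := by
    calc mgf Y P l
        ≤ ∫ ω, (1 + l * Y ω + l ^ 2 * (8 / a ^ 2) * Real.exp (a * |Y ω|)) ∂P :=
          integral_mono (integrable_exp_mul_of_abs_le hY hint (by linarith))
            (((integrable_const _).add (hYi.const_mul _)).add (hint.const_mul _)) hpt
      _ = 1 + l * ∫ ω, Y ω ∂P + l ^ 2 * (8 / a ^ 2) * ∫ ω, Real.exp (a * |Y ω|) ∂P := by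
          have hi : Integrable (fun ω => 1 + l * Y ω) P := (integrable_const _).add (hYi.const_mul _)
          rw [integral_add hi (hint.const_mul _), integral_add (integrable_const _) (hYi.const_mul _), integral_const_mul,
            integral_const_mul]
          simp
      _ ≤ _ := by gcongr
  refine h1.trans (le_trans (le_of_eq ?_) (Real.add_one_le_exp _))
  ring

/-- Doob's inequality for the exponentials of the partial sums of independent variables. -/
theorem measure_exists_le_sum_le {Y : ℕ → Ω → ℝ} (hind : iIndepFun Y P)
    (hm : ∀ i, Measurable (Y i)) {l B x : ℝ} (hl : 0 ≤ l)
    (hint : ∀ i, Integrable (fun ω => Real.exp (l * Y i ω)) P) (h1 : ∀ i, 1 ≤ mgf (Y i) P l)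
    (hB : ∀ i, mgf (Y i) P l ≤ B) (m : ℕ) :
    P {ω | ∃ j < m, x ≤ ∑ k ∈ Finset.range (j + 1), Y k ω} ≤
      ENNReal.ofReal (Real.exp (-l * x) * B ^ m) := by
  obtain _ | m := m
  · simp
  let f : ℕ → Ω → ℝ := fun j ω => Real.exp (l * ∑ k ∈ Finset.range (j + 1), Y k ω)
  have hf : ∀ j, f j = fun ω => Real.exp (l * (∑ k ∈ Finset.range (j + 1), Y k) ω) := fun j => by
    funext ω; simp [f]
  have hfi : ∀ j, Integrable (f j) P := fun j => by
    rw [hf]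
    exact hind.integrable_exp_mul_sum hm fun i _ => hint i
  let 𝒢 := Filtration.natural Y fun i => (hm i).stronglyMeasurable
  have hadY : ∀ k j, k ≤ j → Measurable[𝒢 j] (Y k) := fun k j hkj =>
    ((Filtration.stronglyAdapted_natural fun i => (hm i).stronglyMeasurable) k).measurable.mono
      (𝒢.mono hkj) le_rfl
  have hadf : ∀ j, Measurable[𝒢 j] (f j) := fun j => by
    refine Real.measurable_exp.comp (Measurable.const_mul ?_ l)
    exact Finset.measurable_sum _ fun k hk => hadY k j (by simpa [Nat.lt_succ_iff] using hk)
  -- The new factor `exp (l * Y (j + 1))` is independent of `𝒢 j` and has mean at least `1`, so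
  -- integrals over sets of `𝒢 j` can only grow.
  have hsub : Submartingale f 𝒢 P := by
    refine submartingale_of_setIntegral_le_succ (fun j => (hadf j).stronglyMeasurable) hfi
      fun j s hs => ?_
    have hsm : MeasurableSet s := 𝒢.le j s hs
    rw [← integral_indicator hsm, ← integral_indicator hsm]
    have hsucc : s.indicator (f (j + 1)) =
        fun ω => s.indicator (f j) ω * Real.exp (l * Y (j + 1) ω) := by
      funext ω
      by_cases hω : ω ∈ s
      · simp only [indicator_of_mem hω, f]
        rw [Finset.sum_range_succ _ (j + 1), mul_add, Real.exp_add]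
      · simp [hω]
    have hI : IndepFun (s.indicator (f j)) (fun ω => Real.exp (l * Y (j + 1) ω)) P := by
      have h := hind.indep_comap_natural_of_lt (fun i => (hm i).stronglyMeasurable) j.lt_succ_self
      refine (IndepFun_iff_Indep _ _ _).2 (indep_of_indep_of_le_left
        (indep_of_indep_of_le_right h.symm ?_) ?_)
      · exact ((Real.measurable_exp.comp (measurable_id.const_mul l)).comp
          (comap_measurable (Y (j + 1)))).comap_le
      · exact ((hadf j).indicator hs).comap_le
    rw [hsucc, hI.integral_fun_mul_eq_mul_integral
      ((hfi j).indicator hsm).aestronglyMeasurable (hint _).aestronglyMeasurable]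
    exact le_mul_of_one_le_right (integral_nonneg fun ω =>
      indicator_nonneg (fun _ _ => (Real.exp_pos _).le) ω) (h1 (j + 1))
  have hmax := maximal_ineq hsub (fun j ω => (Real.exp_pos _).le)
    (ε := ⟨Real.exp (l * x), (Real.exp_pos _).le⟩) m
  have hset : {ω | ∃ j < m + 1, x ≤ ∑ k ∈ Finset.range (j + 1), Y k ω} ⊆
      {ω | Real.exp (l * x) ≤ (Finset.range (m + 1)).sup' Finset.nonempty_range_add_one
        fun k => f k ω} := by
    rintro ω ⟨j, hj, hx⟩
    refine le_trans ?_ (Finset.le_sup' (fun k => f k ω) (Finset.mem_range.2 hj))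
    exact Real.exp_le_exp.2 (mul_le_mul_of_nonneg_left hx hl)
  have hE : ∫ ω, f m ω ∂P ≤ B ^ (m + 1) := by
    have h := hind.mgf_sum hm (t := l) (Finset.range (m + 1))
    rw [hf]
    refine (le_of_eq h).trans ?_
    refine (Finset.prod_le_prod (fun i _ => mgf_nonneg) fun i _ => hB i).trans ?_
    simp
  have hfin := (hmax.trans (ENNReal.ofReal_le_ofReal (setIntegral_le_integral (hfi m)
    (ae_of_all _ fun ω => (Real.exp_pos _).le)))).trans (ENNReal.ofReal_le_ofReal hE)
  rw [neg_mul, Real.exp_neg, ENNReal.ofReal_mul (by positivity),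
    ENNReal.ofReal_inv_of_pos (Real.exp_pos _), ← ENNReal.div_eq_inv_mul]
  refine (measure_mono hset).trans ((ENNReal.le_div_iff_mul_le (Or.inl ?_) (Or.inl ?_)).2 ?_)
  · simp [Real.exp_pos]
  · simp
  · rw [mul_comm, ENNReal.ofReal_eq_coe_nnreal (Real.exp_pos _).le]
    exact hfin

end

/-! ### Moderate deviation bounds for sums over blocks -/

section

variable {Ω : Type*} [MeasurableSpace Ω]

/-- For each `n ≥ 1` the variables `Y n i` are i.i.d., with an exponential moment of order `a` that
is at most `M`, uniformly in `n`. -/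
structure UniformExpMoment (P : Measure Ω) (Y : ℕ → ℕ → Ω → ℝ) (a M : ℝ) : Prop where
  pos : 0 < a
  measurable : ∀ n, 1 ≤ n → ∀ i, Measurable (Y n i)
  indep : ∀ n, 1 ≤ n → iIndepFun (Y n) P
  ident : ∀ n, 1 ≤ n → ∀ i, IdentDistrib (Y n i) (Y n 0) P P
  integrable : ∀ n, 1 ≤ n → Integrable (fun ω => Real.exp (a * |Y n 0 ω|)) P
  le : ∀ n, 1 ≤ n → ∫ ω, Real.exp (a * |Y n 0 ω|) ∂P ≤ M

namespace UniformExpMoment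

variable {P : Measure Ω} {Y : ℕ → ℕ → Ω → ℝ} {a M : ℝ}

theorem nonneg (hY : UniformExpMoment P Y a M) : 0 ≤ M :=
  (integral_nonneg fun _ => (Real.exp_pos _).le).trans (hY.le 1 le_rfl)

theorem abs (hY : UniformExpMoment P Y a M) : UniformExpMoment P (fun n i ω => |Y n i ω|) a M where
  pos := hY.pos
  measurable n hn i := continuous_abs.measurable.comp (hY.measurable n hn i)
  indep n hn := (hY.indep n hn).comp (fun _ x => |x|) fun _ => continuous_abs.measurable
  ident n hn i := (hY.ident n hn i).comp continuous_abs.measurable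
  integrable n hn := by simpa using hY.integrable n hn
  le n hn := by simpa using hY.le n hn

variable [IsProbabilityMeasure P]

/-- The sign `σ` handles both tails at once. Centring gives moment generating functions at least
`1`, by `1 + y ≤ exp y`, as the maximal inequality requires; the bound from above is purely
quadratic in `l` since the linear term cancels. -/
theorem measure_exists_le_mul_sum_le (hY : UniformExpMoment P Y a M) {n : ℕ} (hn : 1 ≤ n)
    {σ l x : ℝ} (hσ : |σ| = 1) (hl : 0 ≤ l) (hla : l ≤ a / 2) (s m : ℕ) :
    P {ω | ∃ j < m, x ≤ ∑ k ∈ Finset.range (j + 1), σ * (Y n (s + k) ω - ∫ ω, Y n 0 ω ∂P)} ≤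
      ENNReal.ofReal (Real.exp (-l * x) * Real.exp (8 * M / a ^ 2 * l ^ 2) ^ m) := by
  set e := ∫ ω, Y n 0 ω ∂P
  have ha := hY.pos
  have hid := hY.ident n hn
  have hme := hY.measurable n hn
  have hla' : |l * σ| ≤ a / 2 := by rw [abs_mul, hσ, abs_of_nonneg hl, mul_one]; exact hla
  have hint : ∀ i, Integrable (fun ω => Real.exp (a * |Y n i ω|)) P := fun i =>
    ((hid i).comp (u := fun x => Real.exp (a * |x|)) (by fun_prop)).integrable_iff.2
      (hY.integrable n hn)
  have hY1 : ∀ i, Integrable (Y n i) P := fun i =>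
    integrable_of_integrable_exp_mul_abs (hme i) ha (hint i)
  have hform : ∀ i, (fun ω => Real.exp (l * (σ * (Y n i ω - e)))) =
      fun ω => Real.exp (-(l * σ * e)) * Real.exp (l * σ * Y n i ω) := fun i => by
    funext ω
    rw [← Real.exp_add]
    ring_nf
  have hI : ∀ i, Integrable (fun ω => Real.exp (l * (σ * (Y n i ω - e)))) P := fun i => by
    rw [hform]
    exact (integrable_exp_mul_of_abs_le (hme i) (hint i) (by linarith)).const_mul _
  refine measure_exists_le_sum_le (Y := fun k ω => σ * (Y n (s + k) ω - e))
    (((hY.indep n hn).precomp (add_right_injective s)).comp (fun _ y => σ * (y - e))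
      fun _ => by fun_prop) (fun i => ((hme _).sub_const e).const_mul σ) hl (fun i => hI _)
    (fun i => ?_) (fun i => ?_) m
  · have h0 : ∫ ω, (1 + l * (σ * (Y n (s + i) ω - e))) ∂P = 1 := by
      have hs : Integrable (fun ω => Y n (s + i) ω - e) P := (hY1 _).sub (integrable_const _)
      rw [integral_add (integrable_const _) ((hs.const_mul σ).const_mul l), integral_const_mul,
        integral_const_mul, integral_sub (hY1 _) (integrable_const _), (hid (s + i)).integral_eq]
      simp [e]
    rw [← h0]
    refine integral_mono ((integrable_const _).add
      ((((hY1 _).sub (integrable_const _)).const_mul σ).const_mul l)) (hI _) fun ω => ?_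
    simpa [add_comm] using Real.add_one_le_exp (l * (σ * (Y n (s + i) ω - e)))
  · have h := mgf_le_exp_of_integrable_exp_mul_abs (hme 0) ha (hint 0) (hY.le n hn) hla'
    have h2 : (l * σ) ^ 2 = l ^ 2 := by rw [mul_pow, ← sq_abs σ, hσ]; ring
    rw [h2] at h
    calc mgf (fun ω => σ * (Y n (s + i) ω - e)) P l
        = Real.exp (-(l * σ * e)) * mgf (Y n (s + i)) P (l * σ) := by
          unfold mgf
          rw [hform, integral_const_mul]
      _ = Real.exp (-(l * σ * e)) * mgf (Y n 0) P (l * σ) := by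
          rw [mgf_congr_of_identDistrib _ _ (hid (s + i))]
      _ ≤ Real.exp (-(l * σ * e)) * Real.exp (l * σ * e + 8 * M / a ^ 2 * l ^ 2) := by gcongr
      _ = _ := by rw [← Real.exp_add]; ring_nf

theorem measure_exists_le_abs_sum_le (hY : UniformExpMoment P Y a M) {n : ℕ} (hn : 1 ≤ n)
    {l x : ℝ} (hx : 0 < x) (hl : 0 ≤ l) (hla : l ≤ a / 2) (s m : ℕ) :
    P {ω | ∃ j ≤ m, x ≤ |∑ k ∈ Finset.range j, (Y n (s + k) ω - ∫ ω, Y n 0 ω ∂P)|} ≤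
      ENNReal.ofReal (2 * Real.exp (-l * x + 8 * M / a ^ 2 * l ^ 2 * m)) := by
  have hsub : {ω | ∃ j ≤ m, x ≤ |∑ k ∈ Finset.range j, (Y n (s + k) ω - ∫ ω, Y n 0 ω ∂P)|} ⊆
      {ω | ∃ j < m, x ≤ ∑ k ∈ Finset.range (j + 1), 1 * (Y n (s + k) ω - ∫ ω, Y n 0 ω ∂P)} ∪
      {ω | ∃ j < m, x ≤ ∑ k ∈ Finset.range (j + 1), -1 * (Y n (s + k) ω - ∫ ω, Y n 0 ω ∂P)} := by
    rintro ω ⟨j, hj, hxj⟩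
    obtain _ | j := j
    · simp only [Finset.range_zero, Finset.sum_empty, abs_zero] at hxj
      linarith
    rcases le_abs.1 hxj with h | h
    · exact Or.inl ⟨j, hj, by simpa only [← Finset.mul_sum, one_mul] using h⟩
    · exact Or.inr ⟨j, hj, by rw [← Finset.mul_sum, neg_one_mul]; exact h⟩
  refine (measure_mono hsub).trans ((measure_union_le _ _).trans ?_)
  refine (add_le_add (hY.measure_exists_le_mul_sum_le hn (by simp) hl hla s m)
    (hY.measure_exists_le_mul_sum_le hn (by simp) hl hla s m)).trans (le_of_eq ?_)
  rw [← ENNReal.ofReal_add (by positivity) (by positivity), ← two_mul, Real.exp_add,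
    mul_comm _ (m : ℝ), Real.exp_nat_mul]

/-- Moderate deviation bound for the centred partial sums over a block of length `δ n`. -/
theorem eventually_measure_block_le (hY : UniformExpMoment P Y a M) {b : ℕ → ℝ}
    (hb : Tendsto b atTop atTop)
    (hbn : Tendsto (fun n : ℕ => b n / Real.sqrt n) atTop (𝓝 0)) {κ η δ : ℝ} (hκ : 0 ≤ κ)
    (hη : 0 < η) (hδ : 0 < δ) :
    ∀ᶠ n : ℕ in atTop, ∀ s, P {ω | ∃ j ≤ ⌊(n : ℝ) * δ⌋₊ + 1, η * (b n * Real.sqrt n) ≤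
        |∑ k ∈ Finset.range j, (Y n (s + k) ω - ∫ ω, Y n 0 ω ∂P)|} ≤
      ENNReal.ofReal (Real.exp ((1 - κ * η + 2 * (8 * M / a ^ 2) * κ ^ 2 * δ) * b n ^ 2)) := by
  have ha := hY.pos
  have h1 : ∀ᶠ n : ℕ in atTop, κ * (b n / Real.sqrt n) < a / 2 := by
    have := hbn.const_mul κ
    rw [mul_zero] at this
    exact (tendsto_order.1 this).2 _ (by positivity)
  have h2 : ∀ᶠ n : ℕ in atTop, 1 / δ ≤ (n : ℝ) := tendsto_natCast_atTop_atTop.eventually_ge_atTop _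
  filter_upwards [h1, h2, hb.eventually_ge_atTop 1, eventually_ge_atTop 1] with n h1 h2 hb1 hn s
  have hn0 : (0 : ℝ) < n := by exact_mod_cast hn
  have hsn : 0 < Real.sqrt n := Real.sqrt_pos.2 hn0
  -- With the tilt `l = κ b n / √n` the linear and the quadratic term of the exponent are both of
  -- order `b n ^ 2`. It is admissible because `b n / √n → 0`.
  refine (hY.measure_exists_le_abs_sum_le hn (by positivity) (l := κ * (b n / Real.sqrt n))
    (by positivity) h1.le s _).trans (ENNReal.ofReal_le_ofReal ?_)
  -- The factor `2` from the two tails is absorbed at the cost of the `1` in the exponent.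
  have h3 : (2 : ℝ) ≤ Real.exp (b n ^ 2) := by
    nlinarith [Real.add_one_le_exp (b n ^ 2)]
  have h4 : ((⌊(n : ℝ) * δ⌋₊ + 1 : ℕ) : ℝ) ≤ 2 * δ * n := by
    have := Nat.floor_le (show 0 ≤ (n : ℝ) * δ by positivity)
    rw [div_le_iff₀ hδ] at h2
    push_cast
    linarith
  have h5 : 0 ≤ 8 * M / a ^ 2 := by have := hY.nonneg; positivity
  have h6 : (κ * (b n / Real.sqrt n)) ^ 2 = κ ^ 2 * b n ^ 2 / n := by
    rw [mul_pow, div_pow, Real.sq_sqrt hn0.le]; ring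
  calc 2 * Real.exp (-(κ * (b n / Real.sqrt n)) * (η * (b n * Real.sqrt n)) +
        8 * M / a ^ 2 * (κ * (b n / Real.sqrt n)) ^ 2 * ((⌊(n : ℝ) * δ⌋₊ + 1 : ℕ) : ℝ))
      ≤ Real.exp (b n ^ 2) * Real.exp (-(κ * (b n / Real.sqrt n)) * (η * (b n * Real.sqrt n)) +
        8 * M / a ^ 2 * (κ * (b n / Real.sqrt n)) ^ 2 * (2 * δ * n)) := by gcongr
    _ = _ := by
      rw [← Real.exp_add, h6]
      congr 1
      field_simp
      ring

/-- The threshold `η` is given and the block is shortened: `κ η = A + 2` fixes the linear gain, and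
`δ ≤ 1 / (c + 1)` keeps the quadratic loss below `1`. This serves for the oscillation. -/
theorem exists_forall_block_le (hY : UniformExpMoment P Y a M) {b : ℕ → ℝ}
    (hb : Tendsto b atTop atTop)
    (hbn : Tendsto (fun n : ℕ => b n / Real.sqrt n) atTop (𝓝 0)) {A η : ℝ} (hA : 0 ≤ A)
    (hη : 0 < η) :
    ∃ δ₀ > 0, ∀ δ, 0 < δ → δ ≤ δ₀ → ∀ᶠ n : ℕ in atTop, ∀ s,
      P {ω | ∃ j ≤ ⌊(n : ℝ) * δ⌋₊ + 1, η * (b n * Real.sqrt n) ≤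
        |∑ k ∈ Finset.range j, (Y n (s + k) ω - ∫ ω, Y n 0 ω ∂P)|} ≤
      ENNReal.ofReal (Real.exp (-A * b n ^ 2)) := by
  have ha := hY.pos
  have hM := hY.nonneg
  set κ := (A + 2) / η with hκ
  set c := 2 * (8 * M / a ^ 2) * κ ^ 2 with hc
  have hc0 : 0 ≤ c := by positivity
  refine ⟨1 / (c + 1), by positivity, fun δ hδ hδ' => ?_⟩
  filter_upwards [hY.eventually_measure_block_le hb hbn (show 0 ≤ κ by positivity) hη hδ]
    with n hn s
  refine (hn s).trans (ENNReal.ofReal_le_ofReal (Real.exp_le_exp.2 ?_))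
  refine mul_le_mul_of_nonneg_right ?_ (sq_nonneg _)
  have h1 : κ * η = A + 2 := by rw [hκ]; field_simp
  rw [le_div_iff₀ (by positivity)] at hδ'
  rw [h1, ← hc]
  nlinarith

/-- The block length is given and the threshold is raised: with `κ = 1`, `R` is chosen to make the
exponent exactly `-A`. This serves for the global bound. -/
theorem exists_level_block_le (hY : UniformExpMoment P Y a M) {b : ℕ → ℝ}
    (hb : Tendsto b atTop atTop)
    (hbn : Tendsto (fun n : ℕ => b n / Real.sqrt n) atTop (𝓝 0)) {A δ : ℝ} (hA : 0 ≤ A)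
    (hδ : 0 < δ) :
    ∃ R > 0, ∀ᶠ n : ℕ in atTop, ∀ s,
      P {ω | ∃ j ≤ ⌊(n : ℝ) * δ⌋₊ + 1, R * (b n * Real.sqrt n) ≤
        |∑ k ∈ Finset.range j, (Y n (s + k) ω - ∫ ω, Y n 0 ω ∂P)|} ≤
      ENNReal.ofReal (Real.exp (-A * b n ^ 2)) := by
  have ha := hY.pos
  have hM := hY.nonneg
  refine ⟨A + 1 + 2 * (8 * M / a ^ 2) * δ, by positivity, ?_⟩
  filter_upwards [hY.eventually_measure_block_le hb hbn zero_le_one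
    (show 0 < A + 1 + 2 * (8 * M / a ^ 2) * δ by positivity) hδ] with n hn s
  refine (hn s).trans (ENNReal.ofReal_le_ofReal (Real.exp_le_exp.2 ?_))
  refine mul_le_mul_of_nonneg_right ?_ (sq_nonneg _)
  linarith

end UniformExpMoment

end

/-! ### Pathwise estimates for the linear recursion -/

theorem linear_rec_eq_sum {w a x : ℕ → ℝ} (hw : ∀ i, w (i + 1) = (1 - a i) * w i + x i)
    (s j : ℕ) : w (s + j) = w s - ∑ k ∈ Finset.range j, a (s + k) * w (s + k) +
      ∑ k ∈ Finset.range j, x (s + k) := by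
  induction j with
  | zero => simp
  | succ j ih =>
    rw [← add_assoc, hw, Finset.sum_range_succ, Finset.sum_range_succ, one_sub_mul]
    linarith

/-- Discrete Grönwall bound for a linear recursion. -/
theorem abs_linear_rec_le {w a x : ℕ → ℝ} (hw : ∀ i, w (i + 1) = (1 - a i) * w i + x i) {N : ℕ}
    {c : ℝ} (hc : ∀ j ≤ N, |w 0 + ∑ k ∈ Finset.range j, x k| ≤ c) :
    ∀ j ≤ N, |w j| ≤ c * Real.exp (∑ k ∈ Finset.range j, |a k|) := by
  have h0 : 0 ≤ c := (abs_nonneg _).trans (hc 0 N.zero_le)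
  have h1 : ∀ j ≤ N, |w j| ≤ c + ∑ k ∈ Finset.range j, |a k| * |w k| := fun j hj => by
    have h := linear_rec_eq_sum hw 0 j
    simp only [zero_add] at h
    rw [h, sub_add_eq_add_sub]
    refine (abs_sub _ _).trans (add_le_add (hc j hj) ?_)
    exact (Finset.abs_sum_le_sum_abs _ _).trans_eq (Finset.sum_congr rfl fun k _ => abs_mul _ _)
  -- The majorant, rather than `|w j|` itself, is propagated: one step multiplies it by at most `1 +
  -- |a j| ≤ exp |a j|`.
  have h2 : ∀ j ≤ N, c + ∑ k ∈ Finset.range j, |a k| * |w k| ≤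
      c * Real.exp (∑ k ∈ Finset.range j, |a k|) := fun j => by
    induction j with
    | zero => simp
    | succ j ih =>
      intro hj
      have ih' := ih (by omega)
      rw [Finset.sum_range_succ, Finset.sum_range_succ, Real.exp_add, ← mul_assoc, ← add_assoc]
      have h3 := mul_le_mul_of_nonneg_left (h1 j (by omega)) (abs_nonneg (a j))
      have h4 : 1 + |a j| ≤ Real.exp |a j| := by linarith [Real.add_one_le_exp |a j|]
      have h5 : 0 ≤ c * Real.exp (∑ k ∈ Finset.range j, |a k|) := by positivity
      calc c + ∑ k ∈ Finset.range j, |a k| * |w k| + |a j| * |w j|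
          ≤ (c + ∑ k ∈ Finset.range j, |a k| * |w k|) * (1 + |a j|) := by linarith
        _ ≤ (c * Real.exp (∑ k ∈ Finset.range j, |a k|)) * (1 + |a j|) := by gcongr
        _ ≤ _ := by gcongr
  exact fun j hj => (h1 j hj).trans (h2 j hj)

/-- The recursion satisfied by the moderate-deviation-scaled values. -/
theorem mdScale_rec {n : ℕ} (hn : 1 ≤ n) {b θ μ vstar : ℝ} (hb : 0 < b) (hθ : θ * vstar = μ)
    (m v th x : ℝ) :
    mdScale n b vstar ((1 - th / n) * v + x) = (1 - th / n) * mdScale n b vstar v +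
      ((x - m) / (b * Real.sqrt n) - vstar * (th - θ) / (b * Real.sqrt n) +
        Real.sqrt n / b * (m - μ) / n) := by
  have hn0 : (0 : ℝ) < n := by exact_mod_cast hn
  have hs : 0 < Real.sqrt n := Real.sqrt_pos.2 hn0
  have hsn : (n : ℝ) = Real.sqrt n ^ 2 := (Real.sq_sqrt hn0.le).symm
  unfold mdScale
  rw [← hθ]
  generalize Real.sqrt n = q at *
  rw [hsn]
  field_simp
  ring

theorem abs_sum_noise_le {n : ℕ} (hn : 1 ≤ n) {b θ μ m vstar R₁ R₂ ρ : ℝ} (hb : 0 < b)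
    {th x : ℕ → ℝ} {j : ℕ}
    (hx : |∑ k ∈ Finset.range j, (x k - m)| ≤ R₁ * (b * Real.sqrt n))
    (hth : |∑ k ∈ Finset.range j, (th k - θ)| ≤ R₂ * (b * Real.sqrt n))
    (hρ : |Real.sqrt n / b * (m - μ)| ≤ ρ) :
    |∑ k ∈ Finset.range j, ((x k - m) / (b * Real.sqrt n) -
      vstar * (th k - θ) / (b * Real.sqrt n) + Real.sqrt n / b * (m - μ) / n)| ≤
      R₁ + |vstar| * R₂ + ρ * (j / n) := by
  have hn0 : (0 : ℝ) < n := by exact_mod_cast hn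
  have hs : 0 < b * Real.sqrt n := mul_pos hb (Real.sqrt_pos.2 hn0)
  rw [Finset.sum_add_distrib, Finset.sum_sub_distrib, ← Finset.sum_div, ← Finset.sum_div,
    ← Finset.mul_sum, Finset.sum_const, Finset.card_range, nsmul_eq_mul]
  refine (abs_add_le _ _).trans (add_le_add ((abs_sub _ _).trans (add_le_add ?_ ?_)) ?_)
  · rwa [abs_div, abs_of_pos hs, div_le_iff₀ hs]
  · rw [abs_div, abs_of_pos hs, div_le_iff₀ hs, abs_mul, mul_assoc]
    exact mul_le_mul_of_nonneg_left hth (abs_nonneg _)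
  · rw [abs_mul, abs_div, abs_of_pos hn0, Nat.abs_cast, ← mul_div_assoc, ← mul_div_assoc, mul_comm]
    gcongr

/-- Rounding can cost one extra step, so a cell of length `δ` may need `⌊n δ⌋ + 1` steps; hence the
`+ 1` in the block bounds. -/
theorem natFloor_mul_block {n : ℕ} {δ t : ℝ} (hδ : 0 < δ) (ht : 0 ≤ t) :
    ⌊(n : ℝ) * (δ * ⌊t / δ⌋₊)⌋₊ ≤ ⌊(n : ℝ) * t⌋₊ ∧
      ⌊(n : ℝ) * t⌋₊ ≤ ⌊(n : ℝ) * (δ * ⌊t / δ⌋₊)⌋₊ + (⌊(n : ℝ) * δ⌋₊ + 1) := by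
  have h1 : δ * ⌊t / δ⌋₊ ≤ t := by
    rw [mul_comm, ← le_div_iff₀ hδ]
    exact Nat.floor_le (by positivity)
  have h2 : t < δ * ⌊t / δ⌋₊ + δ := by
    have := Nat.lt_floor_add_one (t / δ)
    rw [div_lt_iff₀ hδ] at this
    linarith
  refine ⟨Nat.floor_le_floor (by gcongr), ?_⟩
  rw [← Nat.lt_add_one_iff]
  have h3 : (⌊(n : ℝ) * t⌋₊ : ℝ) ≤ n * t := Nat.floor_le (by positivity)
  have h4 := Nat.lt_floor_add_one ((n : ℝ) * (δ * ⌊t / δ⌋₊))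
  have h5 := Nat.lt_floor_add_one ((n : ℝ) * δ)
  have h6 : (n : ℝ) * t ≤ n * (δ * ⌊t / δ⌋₊ + δ) := by gcongr
  rw [mul_add] at h6
  have : (⌊(n : ℝ) * t⌋₊ : ℝ) <
      ((⌊(n : ℝ) * (δ * ⌊t / δ⌋₊)⌋₊ + (⌊(n : ℝ) * δ⌋₊ + 1) + 1 : ℕ) : ℝ) := by
    push_cast
    linarith
  exact_mod_cast this

section Path

variable {n : ℕ} {b θ μ m vstar ρ e : ℝ} {V th x : ℕ → ℝ}

/-- Grönwall for the scaled recursion: the coefficients are `th k / n`, so the exponent is the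
average of `|th k|`, bounded by `L`. -/
theorem abs_mdScale_le (hn : 1 ≤ n) (hb : 0 < b) (hθ : θ * vstar = μ)
    (hV : ∀ i, V (i + 1) = (1 - th i / n) * V i + x i)
    (hρ : |Real.sqrt n / b * (m - μ)| ≤ ρ) {N : ℕ} {w₀ R₁ R₂ T L : ℝ} (hN : (N : ℝ) ≤ n * T)
    (h0 : |mdScale n b vstar (V 0)| ≤ w₀)
    (hx : ∀ j ≤ N, |∑ k ∈ Finset.range j, (x k - m)| ≤ R₁ * (b * Real.sqrt n))
    (hth : ∀ j ≤ N, |∑ k ∈ Finset.range j, (th k - θ)| ≤ R₂ * (b * Real.sqrt n))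
    (hL : ∑ k ∈ Finset.range N, |th k| ≤ L * n) :
    ∀ j ≤ N, |mdScale n b vstar (V j)| ≤ (w₀ + (R₁ + |vstar| * R₂ + ρ * T)) * Real.exp L := by
  have hn0 : (0 : ℝ) < n := by exact_mod_cast hn
  have hrec : ∀ i, mdScale n b vstar (V (i + 1)) = _ := fun i =>
    (congrArg _ (hV i)).trans (mdScale_rec hn hb hθ m (V i) (th i) (x i))
  have hρ0 : 0 ≤ ρ := (abs_nonneg _).trans hρ
  have hc : ∀ j ≤ N, |mdScale n b vstar (V 0) + ∑ k ∈ Finset.range j,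
      ((x k - m) / (b * Real.sqrt n) - vstar * (th k - θ) / (b * Real.sqrt n) +
        Real.sqrt n / b * (m - μ) / n)| ≤ w₀ + (R₁ + |vstar| * R₂ + ρ * T) := fun j hj => by
    refine (abs_add_le _ _).trans (add_le_add h0
      ((abs_sum_noise_le hn hb (hx j hj) (hth j hj) hρ).trans ?_))
    have : (j : ℝ) ≤ N := by exact_mod_cast hj
    have : (j : ℝ) / n ≤ T := by rw [div_le_iff₀ hn0]; linarith
    gcongr
  intro j hj
  refine (abs_linear_rec_le (w := fun i => mdScale n b vstar (V i)) hrec hc j hj).trans ?_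
  have h1 := (abs_nonneg _).trans (hc 0 N.zero_le)
  refine mul_le_mul_of_nonneg_left (Real.exp_le_exp.2 ?_) h1
  calc ∑ k ∈ Finset.range j, |th k / n| = (∑ k ∈ Finset.range j, |th k|) / n := by
        simp_rw [abs_div, Nat.abs_cast, Finset.sum_div]
    _ ≤ (∑ k ∈ Finset.range N, |th k|) / n := by
        gcongr
    _ ≤ L := by rwa [div_le_iff₀ hn0]

/-- With the bound `M` on the values known, the linear term contributes at most `M` times the sum of
`|th k| / n` over the block; the rest is noise. -/
theorem abs_mdScale_sub_le (hn : 1 ≤ n) (hb : 0 < b) (hθ : θ * vstar = μ)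
    (hV : ∀ i, V (i + 1) = (1 - th i / n) * V i + x i)
    (hρ : |Real.sqrt n / b * (m - μ)| ≤ ρ) {s j : ℕ} {M R₁ R₂ d L : ℝ} (hj : (j : ℝ) ≤ n * d)
    (hM : ∀ i < s + j, |mdScale n b vstar (V i)| ≤ M) (hM0 : 0 ≤ M)
    (hx : |∑ k ∈ Finset.range j, (x (s + k) - m)| ≤ R₁ * (b * Real.sqrt n))
    (hth : |∑ k ∈ Finset.range j, (th (s + k) - θ)| ≤ R₂ * (b * Real.sqrt n))
    (hL : ∑ k ∈ Finset.range j, |th (s + k)| ≤ L * n) :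
    |mdScale n b vstar (V (s + j)) - mdScale n b vstar (V s)| ≤
      M * L + (R₁ + |vstar| * R₂ + ρ * d) := by
  have hn0 : (0 : ℝ) < n := by exact_mod_cast hn
  have hrec : ∀ i, mdScale n b vstar (V (i + 1)) = _ := fun i =>
    (congrArg _ (hV i)).trans (mdScale_rec hn hb hθ m (V i) (th i) (x i))
  have hρ0 : 0 ≤ ρ := (abs_nonneg _).trans hρ
  have h : mdScale n b vstar (V (s + j)) = _ :=
    linear_rec_eq_sum (w := fun i => mdScale n b vstar (V i)) hrec s j
  rw [h, sub_add, sub_sub_cancel_left, abs_neg]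
  refine (abs_sub _ _).trans (add_le_add ?_ ?_)
  · calc |∑ k ∈ Finset.range j, th (s + k) / n * mdScale n b vstar (V (s + k))|
        ≤ ∑ k ∈ Finset.range j, |th (s + k)| / n * M := by
          refine (Finset.abs_sum_le_sum_abs _ _).trans (Finset.sum_le_sum fun k hk => ?_)
          rw [abs_mul, abs_div, Nat.abs_cast]
          exact mul_le_mul_of_nonneg_left (hM _ (by simpa using hk)) (by positivity)
      _ = M * ((∑ k ∈ Finset.range j, |th (s + k)|) / n) := by
          rw [← Finset.sum_mul, Finset.sum_div, mul_comm]
      _ ≤ M * L := by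
          gcongr
          rwa [div_le_iff₀ hn0]
  · refine (abs_sum_noise_le hn hb hx hth hρ).trans ?_
    have : (j : ℝ) / n ≤ d := by rw [div_le_iff₀ hn0]; linarith
    gcongr

/-- The `th k` are not bounded individually, but their absolute sum is its mean part, at most `n d
e`, plus a fluctuation of order `b √n ≤ n`. -/
theorem sum_abs_le_of_centred {s j : ℕ} {R d : ℝ} (he : 0 ≤ e) (hR : 0 ≤ R)
    (hbn : b * Real.sqrt n ≤ n) (hj : (j : ℝ) ≤ n * d)
    (h : |∑ k ∈ Finset.range j, (|th (s + k)| - e)| ≤ R * (b * Real.sqrt n)) :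
    ∑ k ∈ Finset.range j, |th (s + k)| ≤ (d * e + R) * n := by
  have h1 := (abs_le.1 h).2
  rw [Finset.sum_sub_distrib, Finset.sum_const, Finset.card_range, nsmul_eq_mul] at h1
  have h2 : (j : ℝ) * e ≤ n * d * e := by gcongr
  have h3 : R * (b * Real.sqrt n) ≤ R * n := by gcongr
  linarith

end Path

/-! ### Exponential tightness of step processes -/

theorem ereal_mul_log_le_iff {c A : ℝ} (hc : 0 < c) (p : ℝ≥0∞) :
    ((1 / c : ℝ) : EReal) * ENNReal.log p ≤ ((-A : ℝ) : EReal) ↔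
      p ≤ ENNReal.ofReal (Real.exp (-A * c)) := by
  rw [one_div, EReal.coe_inv, ← EReal.div_eq_inv_mul,
    EReal.div_le_iff_le_mul (by exact_mod_cast hc) (EReal.coe_ne_top c), ← EReal.coe_mul,
    ← ENNReal.log_le_log_iff, ENNReal.log_ofReal_of_pos (Real.exp_pos _), Real.log_exp, mul_comm]

section

variable {Ω : Type*} [MeasurableSpace Ω] {P : Measure Ω} [IsProbabilityMeasure P]

/-- The exceptional sets decrease to `∅` as `M` grows, so finitely many real variables are tight.
This covers the single indices that an asymptotic estimate misses. -/
theorem exists_measure_lt_abs_le {W : ℕ → Ω → ℝ} (hW : ∀ i, Measurable (W i)) (N : ℕ) {p : ℝ≥0∞}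
    (hp : 0 < p) : ∃ M : ℝ, P {ω | ¬ ∀ i ≤ N, |W i ω| ≤ M} ≤ p := by
  let s : ℕ → Set Ω := fun M => {ω | ¬ ∀ i ≤ N, |W i ω| ≤ M}
  have hs : ∀ M, MeasurableSet (s M) := fun M => by
    have : s M = (⋂ i ∈ Finset.range (N + 1), {ω | |W i ω| ≤ M})ᶜ := by
      ext ω
      simp [s]
    rw [this]
    exact (Finset.measurableSet_biInter _ fun i _ =>
      measurableSet_le (continuous_abs.measurable.comp (hW i)) measurable_const).compl
  have hanti : Antitone s := fun M M' h ω hω hc =>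
    hω fun i hi => (hc i hi).trans (by exact_mod_cast h)
  have hempty : ⋂ M, s M = ∅ := by
    refine eq_empty_of_forall_notMem fun ω hω => ?_
    obtain ⟨M, hM⟩ := exists_nat_ge (∑ i ∈ Finset.range (N + 1), |W i ω|)
    refine mem_iInter.1 hω M fun i hi => le_trans ?_ hM
    exact Finset.single_le_sum (f := fun i => |W i ω|) (fun i _ => abs_nonneg _)
      (Finset.mem_range.2 (by omega))
  have h := tendsto_measure_iInter_atTop (μ := P) (fun M => (hs M).nullMeasurableSet) hanti
    ⟨0, measure_ne_top _ _⟩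
  rw [hempty, measure_empty] at h
  obtain ⟨M, hM⟩ := ((tendsto_order.1 h).2 p hp).exists
  exact ⟨M, hM.le⟩

/-- For large `n` the cells of length `δ` give one common net. Each of the finitely many other `n`
gets its own: its path is exactly a function of `⌊n t⌋`, so only the range has to be truncated,
which is possible because `p n > 0`. -/
theorem exists_finite_net_measure_le {T : ℝ} (hT : 0 ≤ T) {W : ℕ → ℕ → Ω → ℝ}
    (hW : ∀ n, 1 ≤ n → ∀ i, Measurable (W n i)) {p : ℕ → ℝ≥0∞} (hp : ∀ n, 0 < p n) {ε : ℝ}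
    (hε : 0 < ε)
    (hosc : ∃ M δ : ℝ, 0 < δ ∧ ∀ᶠ n : ℕ in atTop,
      P {ω | ¬ ((∀ j ≤ ⌊(n : ℝ) * T⌋₊, |W n j ω| ≤ M) ∧ ∀ t : Icc (0 : ℝ) T,
        |W n ⌊(n : ℝ) * t⌋₊ ω - W n ⌊(n : ℝ) * (δ * ⌊(t : ℝ) / δ⌋₊)⌋₊ ω| ≤ ε / 2)} ≤ p n) :
    ∃ F : Set (Icc (0 : ℝ) T → ℝ), F.Finite ∧ ∀ n, 1 ≤ n →
      P {ω | ¬ ∃ f ∈ F, ∀ t : Icc (0 : ℝ) T, |W n ⌊(n : ℝ) * t⌋₊ ω - f t| ≤ ε} ≤ p n := by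
  have hsingle : ∀ n : ℕ, ∃ F : Set (Icc (0 : ℝ) T → ℝ), F.Finite ∧ (1 ≤ n →
      P {ω | ¬ ∃ f ∈ F, ∀ t : Icc (0 : ℝ) T, |W n ⌊(n : ℝ) * t⌋₊ ω - f t| ≤ ε} ≤ p n) := fun n => by
    rcases Nat.eq_zero_or_pos n with rfl | hn
    · exact ⟨∅, finite_empty, by simp⟩
    obtain ⟨M, hM⟩ := exists_measure_lt_abs_le (P := P) (hW n hn) ⌊(n : ℝ) * T⌋₊ (hp n)
    obtain ⟨F, hF, hFx⟩ := exists_finite_net (fun t : Icc (0 : ℝ) T => ⌊(n : ℝ) * t⌋₊)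
      (⌊(n : ℝ) * T⌋₊ + 1)
      (fun t => Nat.lt_succ_of_le (Nat.floor_le_floor (by gcongr; exact t.2.2))) M hε
    refine ⟨F, hF, fun _ => (measure_mono ?_).trans hM⟩
    intro ω hω hc
    exact hω (hFx _ (fun k => W n k ω) (fun k hk => hc k (Nat.lt_succ_iff.1 hk))
      fun t => by simpa using (half_pos hε).le)
  obtain ⟨M, δ, hδ, h⟩ := hosc
  obtain ⟨N, hN⟩ := eventually_atTop.1 h
  obtain ⟨F, hF, hFx⟩ := exists_finite_net (fun t : Icc (0 : ℝ) T => ⌊(t : ℝ) / δ⌋₊)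
    (⌊T / δ⌋₊ + 1) (fun t => Nat.lt_succ_of_le (Nat.floor_le_floor (by gcongr; exact t.2.2))) M hε
  choose G hG hGx using hsingle
  refine ⟨F ∪ ⋃ n ∈ Finset.range N, G n,
    hF.union ((Finset.range N).finite_toSet.biUnion fun n _ => hG n), fun n hn => ?_⟩
  rcases lt_or_ge n N with hnN | hnN
  · refine (measure_mono ?_).trans (hGx n hn)
    rintro ω hω ⟨f, hf, hfx⟩
    exact hω ⟨f, Or.inr (mem_iUnion₂.2 ⟨n, Finset.mem_range.2 hnN, hf⟩), hfx⟩
  · refine (measure_mono ?_).trans (hN n hnN)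
    rintro ω hω ⟨hM, ho⟩
    refine hω ?_
    have hk : ∀ k < ⌊T / δ⌋₊ + 1, |W n ⌊(n : ℝ) * (δ * k)⌋₊ ω| ≤ M := fun k hk => by
      have h1 : (k : ℝ) ≤ T / δ := (Nat.cast_le.2 (Nat.lt_succ_iff.1 hk)).trans
        (Nat.floor_le (by positivity))
      rw [le_div_iff₀ hδ] at h1
      refine hM _ (Nat.floor_le_floor ?_)
      gcongr
      rwa [mul_comm]
    obtain ⟨f, hf, hfx⟩ := hFx (fun t => W n ⌊(n : ℝ) * t⌋₊ ω)
      (fun k => W n ⌊(n : ℝ) * (δ * k)⌋₊ ω) hk ho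
    exact ⟨f, Or.inl hf, hfx⟩

/-- Step processes with a superexponentially controlled range and oscillation are exponentially
tight. -/
theorem exponentiallyTight_of_oscillation {T : ℝ} (hT : 0 ≤ T) {W : ℕ → ℕ → Ω → ℝ}
    (hW : ∀ n, 1 ≤ n → ∀ i, Measurable (W n i)) {x : ℕ → Ω → SkorokhodSpace T}
    (hx : ∀ n ω t, (x n ω).toFun t = W n ⌊(n : ℝ) * t⌋₊ ω) {c : ℕ → ℝ}
    (hc : Tendsto c atTop atTop)
    (hosc : ∀ A ε : ℝ, 0 ≤ A → 0 < ε → ∃ M δ : ℝ, 0 < δ ∧ ∀ᶠ n : ℕ in atTop,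
      P {ω | ¬ ((∀ j ≤ ⌊(n : ℝ) * T⌋₊, |W n j ω| ≤ M) ∧ ∀ t : Icc (0 : ℝ) T,
        |W n ⌊(n : ℝ) * t⌋₊ ω - W n ⌊(n : ℝ) * (δ * ⌊(t : ℝ) / δ⌋₊)⌋₊ ω| ≤ ε)} ≤
      ENNReal.ofReal (Real.exp (-A * c n))) :
    ExponentiallyTight P x c := by
  intro α hα
  -- In the exponent `α + 2 + k`, the `k` makes the sum over precisions geometric, one unit absorbs
  -- the value `2` of that sum, and the other makes the final inequality strict.
  have hnet : ∀ k : ℕ, ∃ F : Set (Icc (0 : ℝ) T → ℝ), F.Finite ∧ ∀ n, 1 ≤ n →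
      P {ω | ¬ ∃ f ∈ F, ∀ t : Icc (0 : ℝ) T, |W n ⌊(n : ℝ) * t⌋₊ ω - f t| ≤ 1 / ((k : ℝ) + 1)} ≤
        ENNReal.ofReal (Real.exp (-(α + 2 + k) * c n)) := fun k =>
    exists_finite_net_measure_le hT hW (fun n => ENNReal.ofReal_pos.2 (Real.exp_pos _))
      (by positivity) (hosc _ _ (by positivity) (by positivity))
  choose F hF hFx using hnet
  obtain ⟨K, hK, hKx⟩ := SkorokhodSpace.exists_isCompact_of_finite_nets hF
    tendsto_one_div_add_atTop_nhds_zero_nat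
  refine ⟨K, hK, ?_⟩
  have hlt : ((-(α + 1) : ℝ) : EReal) < ((-α : ℝ) : EReal) := by
    exact_mod_cast (by linarith : -(α + 1) < -α)
  refine lt_of_le_of_lt (limsup_le_of_le (by isBoundedDefault) ?_) hlt
  filter_upwards [hc.eventually_ge_atTop 1, eventually_ge_atTop 1] with n hcn hn
  rw [ereal_mul_log_le_iff (by linarith)]
  have hsub : {ω | x n ω ∉ K} ⊆
      ⋃ k : ℕ, {ω | ¬ ∃ f ∈ F k, ∀ t : Icc (0 : ℝ) T, |W n ⌊(n : ℝ) * t⌋₊ ω - f t| ≤ 1 / ((k : ℝ) + 1)} := by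
    intro ω hω
    by_contra hcon
    refine hω (hKx _ fun k => ?_)
    by_contra h
    exact hcon (mem_iUnion.2 ⟨k, by simpa only [hx, mem_ofPred_eq] using h⟩)
  have hterm : ∀ k : ℕ, ENNReal.ofReal (Real.exp (-(α + 2 + k) * c n)) ≤
      ENNReal.ofReal (Real.exp (-(α + 2) * c n)) * 2⁻¹ ^ k := fun k => by
    have h2 : Real.exp (-1) ≤ 2⁻¹ := by
      rw [Real.exp_neg]
      exact inv_anti₀ two_pos (by linarith [Real.add_one_le_exp (1 : ℝ)])
    have h3 : (2⁻¹ : ℝ≥0∞) ^ k = ENNReal.ofReal (2⁻¹ ^ k) := by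
      rw [ENNReal.ofReal_pow (by positivity), ENNReal.ofReal_inv_of_pos two_pos]
      simp
    rw [h3, ← ENNReal.ofReal_mul (Real.exp_pos _).le]
    refine ENNReal.ofReal_le_ofReal ?_
    calc Real.exp (-(α + 2 + k) * c n) ≤ Real.exp (-(α + 2) * c n + k * (-1)) := by
          rw [Real.exp_le_exp]
          nlinarith [(Nat.cast_nonneg k : (0 : ℝ) ≤ k)]
      _ = Real.exp (-(α + 2) * c n) * Real.exp (-1) ^ k := by
          rw [Real.exp_add, Real.exp_nat_mul]
      _ ≤ _ := by gcongr
  calc P {ω | x n ω ∉ K}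
      ≤ ∑' k : ℕ, P {ω | ¬ ∃ f ∈ F k, ∀ t : Icc (0 : ℝ) T, |W n ⌊(n : ℝ) * t⌋₊ ω - f t| ≤ 1 / ((k : ℝ) + 1)} :=
        (measure_mono hsub).trans (measure_iUnion_le _)
    _ ≤ ∑' k : ℕ, ENNReal.ofReal (Real.exp (-(α + 2) * c n)) * 2⁻¹ ^ k :=
        ENNReal.tsum_le_tsum fun k => (hFx k n hn).trans (hterm k)
    _ = ENNReal.ofReal (Real.exp (-(α + 2) * c n) * 2) := by
        rw [ENNReal.tsum_mul_left, ENNReal.tsum_geometric, ENNReal.one_sub_inv_two, inv_inv,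
          ENNReal.ofReal_mul (Real.exp_pos _).le]
        simp
    _ ≤ ENNReal.ofReal (Real.exp (-(α + 1) * c n)) := by
        refine ENNReal.ofReal_le_ofReal ?_
        have h4 : (2 : ℝ) ≤ Real.exp (c n) := by linarith [Real.add_one_le_exp (c n)]
        calc Real.exp (-(α + 2) * c n) * 2 ≤ Real.exp (-(α + 2) * c n) * Real.exp (c n) := by
              gcongr
          _ = _ := by rw [← Real.exp_add]; ring_nf

end

/-! ### The moderate-deviation-scaled recursion -/

theorem SuperExpConverges.eventually_measure_le {Ω E : Type*} [MeasurableSpace Ω]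
    [PseudoMetricSpace E] {P : Measure Ω} {x : ℕ → Ω → E} {x₀ : E} {c : ℕ → ℝ}
    (h : SuperExpConverges P x x₀ c) (hc : Tendsto c atTop atTop) {δ : ℝ} (hδ : 0 < δ) (A : ℝ) :
    ∀ᶠ n in atTop, P {ω | δ < dist (x n ω) x₀} ≤ ENNReal.ofReal (Real.exp (-A * c n)) := by
  filter_upwards [EReal.tendsto_nhds_bot_iff_real.1 (h δ hδ) (-A), hc.eventually_gt_atTop 0]
    with n hn hcn
  exact (ereal_mul_log_le_iff hcn _).1 hn.le

section

variable {Ω : Type*} [MeasurableSpace Ω]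

theorem measurable_mdScale_linRec {n : ℕ} {Θ X : ℕ → Ω → ℝ} {V0 : Ω → ℝ}
    (hΘ : ∀ i, Measurable (Θ i)) (hX : ∀ i, Measurable (X i)) (hV0 : Measurable V0) (b vstar : ℝ)
    (i : ℕ) : Measurable fun ω => mdScale n b vstar (linRec n Θ X V0 i ω) := by
  have h : Measurable (linRec n Θ X V0 i) := by
    induction i with
    | zero => exact hV0
    | succ i ih => exact ((measurable_const.sub ((hΘ i).div_const _)).mul ih).add (hX i)
  unfold mdScale
  fun_prop

variable {P : Measure Ω} [IsProbabilityMeasure P]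

/-- The scaled recursion is bounded and has small oscillation over short blocks, up to events of
superexponentially small probability. -/
theorem exists_measure_mdScale_linRec_le {T : ℝ} (hT : 0 < T) {Θ : ℕ → Ω → ℝ}
    {X : ℕ → ℕ → Ω → ℝ} {V0 : ℕ → Ω → ℝ} {b : ℕ → ℝ} {μ r v₀ vstar a₁ M₁ a₂ M₂ : ℝ}
    (hb : Tendsto b atTop atTop)
    (hbn : Tendsto (fun n : ℕ => b n / Real.sqrt n) atTop (𝓝 0))
    (hX : UniformExpMoment P X a₁ M₁) (hΘ : UniformExpMoment P (fun _ => Θ) a₂ M₂)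
    (hr : Tendsto (fun n : ℕ => Real.sqrt n / b n * (∫ ω, X n 0 ω ∂P - μ)) atTop (𝓝 r))
    (hvstar : (∫ ω, Θ 0 ω ∂P) * vstar = μ)
    (hV0 : SuperExpConverges P (fun n ω => mdScale n (b n) vstar (V0 n ω)) v₀
      (fun n => b n ^ 2)) {A ε : ℝ} (hA : 0 ≤ A) (hε : 0 < ε) :
    ∃ M δ : ℝ, 0 < δ ∧ ∀ᶠ n : ℕ in atTop,
      P {ω | ¬ ((∀ j ≤ ⌊(n : ℝ) * T⌋₊,
          |mdScale n (b n) vstar (linRec n Θ (X n) (V0 n) j ω)| ≤ M) ∧ ∀ t : Icc (0 : ℝ) T,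
        |mdScale n (b n) vstar (linRec n Θ (X n) (V0 n) ⌊(n : ℝ) * t⌋₊ ω) -
          mdScale n (b n) vstar
            (linRec n Θ (X n) (V0 n) ⌊(n : ℝ) * (δ * ⌊(t : ℝ) / δ⌋₊)⌋₊ ω)| ≤ ε)} ≤
      ENNReal.ofReal (Real.exp (-A * b n ^ 2)) := by
  -- The spare unit in the exponent will absorb the number of bad events.
  have hA' : 0 ≤ A + 1 := by linarith
  obtain ⟨R₁, hR₁, hG₁⟩ := hX.exists_level_block_le hb hbn hA' hT
  obtain ⟨R₂, hR₂, hG₂⟩ := hΘ.exists_level_block_le hb hbn hA' hT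
  obtain ⟨R₃, hR₃, hG₃⟩ := hΘ.abs.exists_level_block_le hb hbn hA' hT
  set e := ∫ ω, |Θ 0 ω| ∂P
  have he : 0 ≤ e := integral_nonneg fun _ => abs_nonneg _
  set ρ := |r| + 1
  set M := (|v₀| + 1 + (R₁ + |vstar| * R₂ + ρ * T)) * Real.exp (T * e + R₃)
  have hM0 : 0 ≤ M := by positivity
  -- The final oscillation bound is `η (M + 1 + |vstar|) + 2 δ (M e + ρ)`; this `η` and the last
  -- constraint on `δ` make each summand at most `ε / 2`.
  set η := ε / (2 * (M + 1 + |vstar|)) with hη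
  have hη0 : 0 < η := by positivity
  obtain ⟨δ₁, hδ₁, hB₁⟩ := hX.exists_forall_block_le hb hbn hA' hη0
  obtain ⟨δ₂, hδ₂, hB₂⟩ := hΘ.exists_forall_block_le hb hbn hA' hη0
  obtain ⟨δ₃, hδ₃, hB₃⟩ := hΘ.abs.exists_forall_block_le hb hbn hA' hη0
  obtain ⟨δ, hδ, hδle⟩ : ∃ δ > 0, δ ≤ δ₁ ∧ δ ≤ δ₂ ∧ δ ≤ δ₃ ∧ δ ≤ ε / (4 * (M * e + ρ)) := by
    refine ⟨min (min δ₁ δ₂) (min δ₃ (ε / (4 * (M * e + ρ)))), ?_, ?_, ?_, ?_, ?_⟩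
    · have : 0 < ε / (4 * (M * e + ρ)) := by positivity
      exact lt_min (lt_min hδ₁ hδ₂) (lt_min hδ₃ this)
    all_goals simp
  obtain ⟨h₁, h₂, h₃, h₄⟩ := hδle
  -- The number of cells does not depend on `n`. The union bound runs over `4 + 3 D` events: the
  -- initial value, three sums up to time `T`, and three sums in each cell.
  set D := ⌊T / δ⌋₊ + 1
  have hc : Tendsto (fun n => b n ^ 2) atTop atTop := (tendsto_pow_atTop two_ne_zero).comp hb
  refine ⟨M, δ, hδ, ?_⟩
  filter_upwards [hG₁, hG₂, hG₃, hB₁ δ hδ h₁, hB₂ δ hδ h₂, hB₃ δ hδ h₃,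
    hV0.eventually_measure_le hc one_pos (A + 1), hb.eventually_gt_atTop 0,
    (tendsto_order.1 hbn).2 1 one_pos, (tendsto_order.1 hr.abs).2 ρ (lt_add_one _),
    hc.eventually_ge_atTop (4 + 3 * (D : ℝ)), eventually_ge_atTop 1,
    tendsto_natCast_atTop_atTop.eventually_ge_atTop (1 / δ)]
    with n hG₁ hG₂ hG₃ hB₁ hB₂ hB₃ hV hb0 hbn1 hρ hcD hn hnδ
  have hn0 : (0 : ℝ) < n := by exact_mod_cast hn
  have hsn : 0 < Real.sqrt n := Real.sqrt_pos.2 hn0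
  have hbs : b n * Real.sqrt n ≤ n := by
    rw [div_lt_one hsn] at hbn1
    calc b n * Real.sqrt n ≤ Real.sqrt n * Real.sqrt n := by gcongr
      _ = n := Real.mul_self_sqrt hn0.le
  have hu : (4 + 3 * (D : ℝ≥0∞)) * ENNReal.ofReal (Real.exp (-(A + 1) * b n ^ 2)) ≤
      ENNReal.ofReal (Real.exp (-A * b n ^ 2)) := by
    have h : (4 + 3 * (D : ℝ≥0∞)) = ENNReal.ofReal (4 + 3 * (D : ℝ)) := by
      rw [ENNReal.ofReal_add (by positivity) (by positivity), ENNReal.ofReal_mul (by positivity)]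
      simp
    rw [h, ← ENNReal.ofReal_mul (by positivity)]
    refine ENNReal.ofReal_le_ofReal ?_
    calc (4 + 3 * (D : ℝ)) * Real.exp (-(A + 1) * b n ^ 2)
        ≤ Real.exp (b n ^ 2) * Real.exp (-(A + 1) * b n ^ 2) := by
          gcongr
          linarith [Real.add_one_le_exp (b n ^ 2)]
      _ = _ := by rw [← Real.exp_add]; ring_nf
  refine le_trans ?_ hu
  set u := ENNReal.ofReal (Real.exp (-(A + 1) * b n ^ 2))
  let bad (Y : ℕ → Ω → ℝ) (R d : ℝ) (s : ℕ) : Set Ω :=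
    {ω | ∃ j ≤ ⌊(n : ℝ) * d⌋₊ + 1, R * (b n * Real.sqrt n) ≤
      |∑ k ∈ Finset.range j, (Y (s + k) ω - ∫ ω, Y 0 ω ∂P)|}
  let absΘ : ℕ → Ω → ℝ := fun i ω => |Θ i ω|
  let blk (q : ℕ) : Set Ω := bad (X n) η δ ⌊(n : ℝ) * (δ * q)⌋₊ ∪
    bad Θ η δ ⌊(n : ℝ) * (δ * q)⌋₊ ∪ bad absΘ η δ ⌊(n : ℝ) * (δ * q)⌋₊
  let B : Set Ω := {ω | 1 < dist (mdScale n (b n) vstar (V0 n ω)) v₀} ∪ bad (X n) R₁ T 0 ∪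
    bad Θ R₂ T 0 ∪ bad absΘ R₃ T 0 ∪ ⋃ q ∈ Finset.range D, blk q
  have hblk : ∀ q, P (blk q) ≤ 3 * u := fun q => by
    refine (measure_union_le _ _).trans ((add_le_add ((measure_union_le _ _).trans
      (add_le_add (hB₁ _) (hB₂ _))) (hB₃ _)).trans (le_of_eq ?_))
    ring
  have hBu : P B ≤ (4 + 3 * (D : ℝ≥0∞)) * u := by
    calc P B ≤ u + u + u + u + ∑ q ∈ Finset.range D, 3 * u :=
          (measure_union_le _ _).trans (add_le_add ((measure_union_le _ _).trans (add_le_add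
            ((measure_union_le _ _).trans (add_le_add ((measure_union_le _ _).trans
              (add_le_add hV (hG₁ 0))) (hG₂ 0))) (hG₃ 0)))
            ((measure_biUnion_finset_le _ _).trans (Finset.sum_le_sum fun q _ => hblk q)))
      _ = _ := by
          rw [Finset.sum_const, Finset.card_range, nsmul_eq_mul]
          ring
  refine (measure_mono fun ω hω => ?_).trans hBu
  by_contra hωB
  refine hω ?_
  simp only [B, mem_union, not_or] at hωB
  obtain ⟨⟨⟨⟨hv, hx⟩, hth⟩, hath⟩, hq⟩ := hωB
  have hgood : ∀ {Y : ℕ → Ω → ℝ} {R d : ℝ} {s : ℕ}, ω ∉ bad Y R d s →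
      ∀ j ≤ ⌊(n : ℝ) * d⌋₊ + 1, |∑ k ∈ Finset.range j, (Y (s + k) ω - ∫ ω, Y 0 ω ∂P)| ≤
        R * (b n * Real.sqrt n) := fun h j hj => by
    by_contra hc
    exact h ⟨j, hj, (not_le.1 hc).le⟩
  have hfl : ((⌊(n : ℝ) * T⌋₊ : ℕ) : ℝ) ≤ n * T := Nat.floor_le (by positivity)
  have h0 : |mdScale n (b n) vstar (linRec n Θ (X n) (V0 n) 0 ω)| ≤ |v₀| + 1 := by
    have h : |mdScale n (b n) vstar (V0 n ω) - v₀| ≤ 1 := not_lt.1 hv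
    have := abs_sub_abs_le_abs_sub (mdScale n (b n) vstar (V0 n ω)) v₀
    simp only [linRec]
    linarith
  have hL := sum_abs_le_of_centred (th := fun i => Θ i ω) he hR₃.le hbs hfl
    (hgood hath ⌊(n : ℝ) * T⌋₊ (by omega))
  have hmax : ∀ j ≤ ⌊(n : ℝ) * T⌋₊,
      |mdScale n (b n) vstar (linRec n Θ (X n) (V0 n) j ω)| ≤ M :=
    abs_mdScale_le (V := fun i => linRec n Θ (X n) (V0 n) i ω) (th := fun i => Θ i ω)
      (x := fun i => X n i ω) hn hb0 hvstar (fun _ => rfl) hρ.le hfl h0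
      (fun j hj => by simpa only [zero_add] using hgood hx j (by omega))
      (fun j hj => by simpa only [zero_add] using hgood hth j (by omega))
      (by simpa only [zero_add] using hL)
  refine ⟨hmax, fun t => ?_⟩
  obtain ⟨hs, hst⟩ := natFloor_mul_block (n := n) hδ t.2.1
  set s := ⌊(n : ℝ) * (δ * ⌊(t : ℝ) / δ⌋₊)⌋₊
  obtain ⟨j, hj⟩ := Nat.exists_eq_add_of_le hs
  have hjl : j ≤ ⌊(n : ℝ) * δ⌋₊ + 1 := by omega
  have hjd : (j : ℝ) ≤ n * (2 * δ) := by
    have h5 : (j : ℝ) ≤ ((⌊(n : ℝ) * δ⌋₊ + 1 : ℕ) : ℝ) := by exact_mod_cast hjl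
    have h6 := Nat.floor_le (show 0 ≤ (n : ℝ) * δ by positivity)
    rw [div_le_iff₀ hδ] at hnδ
    push_cast at h5
    linarith
  have hqt : ω ∉ blk ⌊(t : ℝ) / δ⌋₊ := fun h => hq (mem_iUnion₂.2 ⟨_, Finset.mem_range.2
    (Nat.lt_succ_of_le (Nat.floor_le_floor (by gcongr; exact t.2.2))), h⟩)
  simp only [blk, mem_union, not_or] at hqt
  obtain ⟨⟨hqx, hqth⟩, hqath⟩ := hqt
  have hst' : s + j ≤ ⌊(n : ℝ) * T⌋₊ := hj ▸ Nat.floor_le_floor (by gcongr; exact t.2.2)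
  rw [hj]
  refine (abs_mdScale_sub_le (V := fun i => linRec n Θ (X n) (V0 n) i ω) (th := fun i => Θ i ω)
    (x := fun i => X n i ω) hn hb0 hvstar (fun _ => rfl) hρ.le hjd
    (fun i hi => hmax i (by omega)) hM0 (hgood hqx j hjl) (hgood hqth j hjl)
    (sum_abs_le_of_centred (th := fun i => Θ i ω) he hη0.le hbs hjd
        (hgood hqath j hjl))).trans ?_
  have h7 : η * (2 * (M + 1 + |vstar|)) = ε := by rw [hη]; field_simp
  rw [le_div_iff₀ (by positivity)] at h₄
  linarith

end
theorem theorem4p4 {Ω : Type*} [MeasurableSpace Ω] (P : Measure Ω) [IsProbabilityMeasure P]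
    (T : ℝ) (hT : 0 < T)
    -- the data of the systems: `X n i`, `V0 n` and `b n` belong to the `n`-th one, `n ≥ 1`
    (Θ : ℕ → Ω → ℝ) (X : ℕ → ℕ → Ω → ℝ) (V0 : ℕ → Ω → ℝ) (b : ℕ → ℝ)
    (μ σX r v₀ vstar : ℝ)
    (hb : Tendsto b atTop atTop)
    (hbn : Tendsto (fun n : ℕ => b n / Real.sqrt n) atTop (𝓝 0))
    -- `Θ` is an i.i.d. sequence with finite mean and variance
    (hΘm : ∀ i, Measurable (Θ i))
    (hΘind : iIndepFun Θ P)
    (hΘid : ∀ i, IdentDistrib (Θ i) (Θ 0) P P)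
    (hΘ2 : MemLp (Θ 0) 2 P)
    -- each `X n` is an i.i.d. sequence with finite mean and variance, independent of `Θ`
    (hXm : ∀ n, 1 ≤ n → ∀ i, Measurable (X n i))
    (hXind : ∀ n, 1 ≤ n → iIndepFun (X n) P)
    (hXid : ∀ n, 1 ≤ n → ∀ i, IdentDistrib (X n i) (X n 0) P P)
    (hX2 : ∀ n, 1 ≤ n → MemLp (X n 0) 2 P)
    (hXΘ : ∀ n, 1 ≤ n → IndepFun (fun ω i => X n i ω) (fun ω i => Θ i ω) P)
    (hμ : Tendsto (fun n => ∫ ω, X n 0 ω ∂P) atTop (𝓝 μ))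
    (hσ : Tendsto (fun n => variance (X n 0) P) atTop (𝓝 (σX ^ 2)))
    (hσpos : 0 < σX)
    -- exponential moments
    (hexp : ∃ a : ℝ, 0 < a ∧ Integrable (fun ω => Real.exp (a * |Θ 0 ω|)) P ∧
      ∃ M : ℝ, ∀ n, 1 ≤ n → Integrable (fun ω => Real.exp (a * |X n 0 ω|)) P ∧
        ∫ ω, Real.exp (a * |X n 0 ω|) ∂P ≤ M)
    (hr : Tendsto (fun n : ℕ => Real.sqrt n / b n * (∫ ω, X n 0 ω ∂P - μ)) atTop (𝓝 r))
    -- the centering constant and the initial values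
    (hvstar : IsStableFixedPoint (∫ ω, Θ 0 ω ∂P) μ vstar)
    (hV0m : ∀ n, 1 ≤ n → Measurable (V0 n))
    (hV0 : SuperExpConverges P (fun n ω => mdScale n (b n) vstar (V0 n ω)) v₀
      (fun n => b n ^ 2)) :
    ExponentiallyTight P
      (fun n => mdProcess T n (b n) vstar (linRec n Θ (X n) (V0 n)))
      (fun n => b n ^ 2) := by
  obtain ⟨a, ha, hΘexp, M, hXexp⟩ := hexp
  have hX : UniformExpMoment P X a M := ⟨ha, hXm, hXind, hXid, fun n hn => (hXexp n hn).1,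
    fun n hn => (hXexp n hn).2⟩
  have hΘ : UniformExpMoment P (fun _ => Θ) a (∫ ω, Real.exp (a * |Θ 0 ω|) ∂P) :=
    ⟨ha, fun _ _ => hΘm, fun _ _ => hΘind, fun _ _ => hΘid, fun _ _ => hΘexp, fun _ _ => le_rfl⟩
  have hfix : (∫ ω, Θ 0 ω ∂P) * vstar = μ := by
    rcases hvstar with ⟨h, rfl⟩ | ⟨h, rfl, rfl⟩
    · exact mul_div_cancel₀ _ h.ne'
    · simp
  exact exponentiallyTight_of_oscillation hT.le
    (W := fun n i ω => mdScale n (b n) vstar (linRec n Θ (X n) (V0 n) i ω))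
    (fun n hn i => measurable_mdScale_linRec hΘm (hXm n hn) (hV0m n hn) _ _ i)
    (fun _ _ _ => rfl) ((tendsto_pow_atTop two_ne_zero).comp hb)
    fun A ε hA hε => exists_measure_mdScale_linRec_le hT hb hbn hX hΘ hr hfix hV0 hA hε
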